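/- Let $N$ be a Sol-manifold which is a torus bundle over $S^1$; that is, $N$ is the total space of a fibre bundle over $S^1$ whose fibre is the 2-torus $T$ and for which the eigenvalues of the monodromy $H_1(T;\mathbb{Z})\to H_1(T;\mathbb{Z})$ are $e^{-t}$ and $e^{t}$ for some real $t>0$. Then $\pi_1(N)$ does not have a finite index subgroup which is residually $p$ for all primes $p$. (A group $G$ is residually $p$ if for every non-trivial $g\in G$ there is a homomorphism $\alpha$ from $G$ to a finite group of $p$-power order such that $\alpha(g)\neq 1$.) -/

import Mathlib

universe u v

/-- A group `G` is residually `p` if every non-trivial element of `G` survives under some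
homomorphism from `G` to a finite group whose order is a power of `p`. -/
def IsResiduallyP (p : ℕ) (G : Type u) [Group G] : Prop :=
  ∀ g : G, g ≠ 1 → ∃ (P : Type u) (_ : Group P) (f : G →* P),
    (∃ n : ℕ, Nat.card P = p ^ n) ∧ f g ≠ 1

/-- `q : E → B` is a (locally trivial) fibre bundle with fibre `F`. -/
def IsFibreBundleMap (F : Type v) [TopologicalSpace F] {E B : Type*} [TopologicalSpace E]
    [TopologicalSpace B] (q : E → B) : Prop :=
  ∀ b : B, ∃ e : Bundle.Trivialization F q, b ∈ e.baseSet

/-- The `2`-torus. -/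
abbrev Torus2 : Type := Circle × Circle

/-- The loop `s ↦ exp (2πis)`, `0 ≤ s ≤ 1`, which runs once around the circle. -/
noncomputable def circleLoop (s : unitInterval) : Circle :=
  Circle.exp (2 * Real.pi * (s : ℝ))

/-- The total space of the pull-back of `q : E → S¹` along the loop `s ↦ exp (2πis)`. -/
def LoopPullback {E : Type u} (q : E → Circle) : Type u :=
  {z : unitInterval × E // circleLoop z.1 = q z.2}

instance {E : Type u} [TopologicalSpace E] (q : E → Circle) :
    TopologicalSpace (LoopPullback q) :=
  inferInstanceAs (TopologicalSpace {z : unitInterval × E // circleLoop z.1 = q z.2})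

/-- The homeomorphism `h : F → F` is a monodromy of the bundle `q : E → S¹` with fibre `F`: there
is a trivialization `Φ` over `[0, 1]` of the pull-back of the bundle along the loop
`s ↦ exp (2πis)` such that, inside the fibre of `q` over `1`, the identification of `F` with this
fibre at the end `s = 1` is the one at the start `s = 0` composed with `h`.
(Equivalently, `E` is obtained from `F × [0, 1]` by gluing `(x, 1)` to `(h x, 0)`.) -/
def IsMonodromy {F : Type v} [TopologicalSpace F] {E : Type u} [TopologicalSpace E]
    (q : E → Circle) (h : F ≃ₜ F) : Prop :=
  ∃ Φ : F × unitInterval ≃ₜ LoopPullback q,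
    (∀ x s, (Φ (x, s)).1.1 = s) ∧ ∀ x, (Φ (x, 1)).1.2 = (Φ (h x, 0)).1.2

/-- The first singular homology group `H₁(X; ℤ)`. -/
noncomputable abbrev singularH1 (X : Type) [TopologicalSpace X] : ModuleCat.{0} ℤ :=
  ((AlgebraicTopology.singularHomologyFunctor (ModuleCat.{0} ℤ) 1).obj
    (ModuleCat.of ℤ ℤ)).obj (TopCat.of X)

/-- The endomorphism of `H₁(X; ℤ)` induced by a continuous self-map of `X`. -/
noncomputable def singularH1Map {X : Type} [TopologicalSpace X] (f : C(X, X)) :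
    singularH1 X →ₗ[ℤ] singularH1 X :=
  (((AlgebraicTopology.singularHomologyFunctor (ModuleCat.{0} ℤ) 1).obj
    (ModuleCat.of ℤ ℤ)).map (TopCat.ofHom f)).hom

/-- The set of (complex) eigenvalues of an endomorphism of an abelian group `A`, that is, the
eigenvalues of the induced endomorphism of `ℂ ⊗ A`. -/
def complexEigenvalues {A : Type} [AddCommGroup A] [Module ℤ A] (φ : A →ₗ[ℤ] A) : Set ℂ :=
  {μ | Module.End.HasEigenvalue (φ.baseChange ℂ) μ}

/-- `N` is a Sol-manifold which is a torus bundle over `S¹`: there is a fibre bundle `N → S¹` with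
fibre the `2`-torus `T`, for which the eigenvalues of the monodromy `H₁(T; ℤ) → H₁(T; ℤ)` are
`e⁻ᵗ` and `eᵗ` for some `t > 0`. (Any such `N` is a closed orientable `3`-manifold.) -/
def IsSolTorusBundle (N : Type u) [TopologicalSpace N] : Prop :=
  ∃ q : N → Circle, IsFibreBundleMap Torus2 q ∧
    ∃ h : Torus2 ≃ₜ Torus2, IsMonodromy q h ∧
      ∃ t : ℝ, 0 < t ∧
        complexEigenvalues (singularH1Map (h : C(Torus2, Torus2))) =
          {((Real.exp (-t) : ℝ) : ℂ), ((Real.exp t : ℝ) : ℂ)}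

/-!
The fundamental group of a torus bundle over the circle with monodromy `h` contains `ℤ² = π₁(T)`
together with an element `t` (a lift of the loop in the base) which acts on `ℤ²` by conjugation
through the integral matrix `A` of `h`. If no positive power of `A` has eigenvalue `1`, such a
group cannot virtually be residually `p` for all `p`: a finite index subgroup contains `m ℤ²` and
`tᵐ` for some `m > 0`, and for a prime `p` not dividing `det (Aᵐ - 1)` the endomorphism `Aᵐ - 1`
is invertible modulo `p`, so every element of `m ℤ²` is, modulo `p`-th powers, an iterated
commutator with `tᵐ`. Hence every homomorphism to a finite `p`-group, which is nilpotent, kills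
`m ℤ²` (`eq_one_of_conj_of_coprime_det`, `not_residuallyP_of_hyperbolic_conj`).

The topological input consists of three facts, all obtained from lifting circle-valued maps
through `exp : ℝ → S¹`.

* Each self-map of the torus is homotopic to the linear endomorphism of an integral matrix
  (`exists_homotopic_torusEnd`). This gives `A`, and the monodromy then yields a homotopy from the
  inclusion of the fibre to its composite with the endomorphism `A`; the track of the base point is
  the conjugating element `t` (`exists_conj_eq`).
* The eigenvalues of `h` on `H₁(T; ℤ)` control `A`. If `Aᵏ v = v`, then by homotopy invariance the
  homology class of the loop of winding vector `v` is fixed by the `k`-th power of `h`. For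
  `v ≠ 0` this class is not torsion, since the change of argument along `1`-simplices is a real
  singular cocycle on the circle which detects it (`d_argCochain`). So some root of unity would be
  an eigenvalue, whereas `e⁻ᵗ` and `eᵗ` are not of absolute value `1`
  (`det_pow_sub_one_ne_zero`).
* The fibre is `π₁`-injective (`fibre_winding_injective`). The bundle becomes trivial when pulled
  back to `ℝ`, so this pull-back maps to the fibre, compatibly with the inclusion of the fibre over
  `0` (`exists_retraction_realPullback`). A null-homotopy in the total space lifts to the pull-back,
  and is thereby transported to the fibre.
-/

/-! ### Groups containing a hyperbolic extension of a lattice -/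

section GroupTheory

open Matrix commutatorElement

/-- The relation `t i(v) t⁻¹ = i(A v)` iterates to `tᵏ i(v) t⁻ᵏ = i(Aᵏ v)`. -/
theorem pow_mul_eq_of_mul_eq {ι G : Type*} [Fintype ι] [DecidableEq ι] [Group G]
    {A : Matrix ι ι ℤ} {i : Multiplicative (ι → ℤ) →* G} {t : G}
    (hconj : ∀ v, t * i (.ofAdd v) = i (.ofAdd (A *ᵥ v)) * t) (k : ℕ) (v : ι → ℤ) :
    t ^ k * i (.ofAdd v) = i (.ofAdd (A ^ k *ᵥ v)) * t ^ k := by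
  induction k generalizing v with
  | zero => simp
  | succ k ih =>
    rw [pow_succ, mul_assoc, hconj, ← mul_assoc, ih, mul_assoc, mulVec_mulVec, ← pow_succ]

/-- If `s` normalizes the image of a homomorphism `j` from `ℤⁿ` to a finite `p`-group, acting
through `B`, and `p` does not divide `det (B - 1)`, then `j` is trivial. Indeed the elements
`j ((B - 1)ⁿ v)` are `n`-fold commutators, hence trivial for large `n`, whereas `B - 1` is
invertible modulo `p`. -/
theorem eq_one_of_conj_of_coprime_det {ι P : Type*} [Fintype ι] [DecidableEq ι] [Group P]
    {p n : ℕ} [hp : Fact p.Prime] (hP : Nat.card P = p ^ n) {B : Matrix ι ι ℤ}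
    (hdet : IsCoprime (B - 1).det (p : ℤ))
    (j : Multiplicative (ι → ℤ) →* P) {s : P}
    (hconj : ∀ v, s * j (.ofAdd v) = j (.ofAdd (B *ᵥ v)) * s) (v : ι → ℤ) :
    j (.ofAdd v) = 1 := by
  have : Finite P := Nat.finite_of_card_ne_zero (by rw [hP]; exact pow_ne_zero _ hp.out.ne_zero)
  have hPg : IsPGroup p P := IsPGroup.of_card hP
  obtain ⟨N, hN⟩ := Subgroup.nilpotent_iff_lowerCentralSeries.mp hPg.isNilpotent
  have hmem : ∀ m (w : ι → ℤ),
      j (.ofAdd ((B - 1) ^ m *ᵥ w)) ∈ Subgroup.lowerCentralSeries (⊤ : Subgroup P) m := by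
    intro m
    induction m with
    | zero => intro w; exact Subgroup.mem_top _
    | succ m ih =>
      intro w
      have h1 : j (.ofAdd ((B - 1) ^ (m + 1) *ᵥ w)) = ⁅s, j (.ofAdd ((B - 1) ^ m *ᵥ w))⁆ := by
        rw [commutatorElement_def, hconj, pow_succ', ← mulVec_mulVec, sub_mulVec, one_mulVec,
          ofAdd_sub, map_div, div_eq_mul_inv]
        group
      rw [h1, Subgroup.lowerCentralSeries_succ, Subgroup.commutator_comm]
      exact Subgroup.commutator_mem_commutator (Subgroup.mem_top _) (ih w)
  -- `(B - 1)ᴺ` divides the scalar `det (B - 1)ᴺ`, so `j v` is killed by a power of the determinant.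
  have hkill : j (.ofAdd v) ^ ((B - 1).det ^ N) = 1 := by
    rw [← map_zpow, ← ofAdd_zsmul]
    have h2 : ((B - 1).det ^ N) • v = (B - 1) ^ N *ᵥ ((B - 1).adjugate ^ N *ᵥ v) := by
      have h3 : (B - 1) ^ N * (B - 1).adjugate ^ N = ((B - 1).det ^ N) • (1 : Matrix ι ι ℤ) := by
        rw [← Commute.mul_pow, mul_adjugate, smul_pow, one_pow]
        exact (mul_adjugate _).trans (adjugate_mul _).symm
      rw [mulVec_mulVec, h3, smul_mulVec, one_mulVec]
    rw [h2]
    have := hmem N ((B - 1).adjugate ^ N *ᵥ v)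
    rwa [hN, Subgroup.mem_bot] at this
  have hkill' : j (.ofAdd v) ^ ((p : ℤ) ^ n) = 1 := by
    have := pow_card_eq_one' (x := j (.ofAdd v))
    rw [hP] at this
    exact_mod_cast this
  have hc : IsCoprime ((B - 1).det ^ N) ((p : ℤ) ^ n) := hdet.pow
  obtain ⟨a, b, hab⟩ := hc
  rw [← zpow_one (j (.ofAdd v)), ← hab, _root_.zpow_add, mul_comm a, mul_comm b,
    _root_.zpow_mul, _root_.zpow_mul, hkill, hkill', _root_.one_zpow, _root_.one_zpow, one_mul]

/-- A group containing `ℤⁿ` (`n ≥ 1`) and an element normalizing it through a matrix none of whose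
positive powers has eigenvalue `1` does not virtually have the property of being residually `p`
for all primes `p`. -/
theorem not_residuallyP_of_hyperbolic_conj {ι : Type*} [Fintype ι] [DecidableEq ι] [Nonempty ι]
    {G : Type u} [Group G] {A : Matrix ι ι ℤ} (hA : ∀ k, 0 < k → (A ^ k - 1).det ≠ 0)
    {i : Multiplicative (ι → ℤ) →* G} (hi : Function.Injective i) {t : G}
    (hconj : ∀ v, t * i (.ofAdd v) = i (.ofAdd (A *ᵥ v)) * t) :
    ¬ ∃ H : Subgroup G, H.FiniteIndex ∧ ∀ p : ℕ, p.Prime → IsResiduallyP p H := by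
  rintro ⟨H, hH, hres⟩
  -- This exponent works for the elements of `ℤⁿ` and for `t` at the same time.
  set m := H.index.factorial
  have hm0 : m ≠ 0 := Nat.factorial_ne_zero _
  have hpow : ∀ g : G, g ^ m ∈ H := fun g ↦
    Subgroup.pow_mem_of_index_ne_zero_of_dvd hH.index_ne_zero g
      fun k hk hk' ↦ Nat.dvd_factorial hk hk'
  -- The determinant is not zero, so any prime exceeding it is coprime to it.
  obtain ⟨p, hpd, hp⟩ := Nat.exists_infinite_primes ((A ^ m - 1).det.natAbs + 1)
  have : Fact p.Prime := ⟨hp⟩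
  have hcop : IsCoprime (A ^ m - 1).det (p : ℤ) := by
    rw [Int.isCoprime_iff_gcd_eq_one, Int.gcd_eq_natAbs, Int.natAbs_natCast, Nat.gcd_comm]
    refine (Nat.Prime.coprime_iff_not_dvd hp).mpr fun hdvd ↦ ?_
    have := Nat.le_of_dvd (Int.natAbs_pos.mpr (hA m (Nat.pos_of_ne_zero hm0))) hdvd
    omega
  -- The restriction of `i` to `m ℤⁿ` takes values in `H`.
  let j : Multiplicative (ι → ℤ) →* H :=
    (i.comp (powMonoidHom m)).codRestrict H fun v ↦ by simpa using hpow (i v)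
  have hj : ∀ v, (j v : G) = i (v ^ m) := fun v ↦ rfl
  let v : ι → ℤ := fun _ ↦ 1
  have hne : j (.ofAdd v) ≠ 1 := by
    intro h
    have h1 : i (.ofAdd v ^ m) = 1 := by rw [← hj, h]; rfl
    rw [← map_one i] at h1
    have h2 : m • v = 0 := congrArg Multiplicative.toAdd (hi h1)
    have h3 := congrFun h2 (Classical.arbitrary ι)
    simp [v, hm0] at h3
  obtain ⟨P, _, f, ⟨n, hP⟩, hf⟩ := hres p hp _ hne
  refine hf (eq_one_of_conj_of_coprime_det hP hcop (f.comp j) (s := f ⟨t ^ m, hpow t⟩) ?_ v)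
  intro w
  rw [MonoidHom.comp_apply, MonoidHom.comp_apply, ← map_mul, ← map_mul]
  congr 1
  refine Subtype.ext ?_
  rw [Subgroup.coe_mul, Subgroup.coe_mul, hj, hj, ← ofAdd_nsmul, ← ofAdd_nsmul]
  rw [pow_mul_eq_of_mul_eq hconj, mulVec_smul]

end GroupTheory

/-! ### Arguments of circle-valued maps -/

/-- A circle-valued map on a contractible space has a continuous argument: lift a contraction. -/
theorem exists_circle_lift {X : Type*} [TopologicalSpace X] [ContractibleSpace X]
    (f : C(X, Circle)) : ∃ θ : C(X, ℝ), ∀ x, Circle.exp (θ x) = f x := by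
  obtain ⟨z, ⟨F⟩⟩ := id_nullhomotopic X
  obtain ⟨e, he⟩ := Circle.exp_surjective (f z)
  let H : C(unitInterval × X, Circle) := f.comp F.symm.toContinuousMap
  have H0 : ∀ x, H (0, x) = Circle.exp (ContinuousMap.const X e x) := by
    intro x; simp [H, he]
  refine ⟨(Circle.isCoveringMap_exp.liftHomotopy H _ H0).comp
    ((ContinuousMap.const X 1).prodMk (.id X)), fun x ↦ ?_⟩
  have := congrFun (Circle.isCoveringMap_exp.liftHomotopy_lifts H _ H0) (1, x)
  simpa [H] using this

/-- An argument of the constant function `1` on a connected space is constant. -/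
theorem eq_of_circle_exp_eq_one {X : Type*} [TopologicalSpace X] [PreconnectedSpace X]
    {θ : X → ℝ} (hθ : Continuous θ) (h : ∀ x, Circle.exp (θ x) = 1) (x y : X) : θ x = θ y :=
  Circle.isCoveringMap_exp.const_of_comp hθ (fun x y ↦ by simp [h]) x y

/-- Two arguments of the same circle-valued function on a connected space differ by a constant
multiple of `2π`. -/
theorem exists_int_of_circle_exp_eq {X : Type*} [TopologicalSpace X] [PreconnectedSpace X]
    [Nonempty X] {θ θ' : X → ℝ} (hθ : Continuous θ) (hθ' : Continuous θ')
    (h : ∀ x, Circle.exp (θ x) = Circle.exp (θ' x)) :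
    ∃ n : ℤ, ∀ x, θ x = θ' x + 2 * Real.pi * n := by
  have h1 : ∀ x, Circle.exp (θ x - θ' x) = 1 := fun x ↦ by rw [Circle.exp_sub, h, div_self']
  have h2 := eq_of_circle_exp_eq_one (hθ.sub hθ') h1
  let x₀ := Classical.arbitrary X
  obtain ⟨n, hn⟩ := Circle.exp_eq_one.mp (h1 x₀)
  refine ⟨n, fun x ↦ ?_⟩
  have : θ x - θ' x = θ x₀ - θ' x₀ := h2 x x₀
  linarith

/-! ### Self-maps of the torus -/

/-- The endomorphism of the torus with matrix `A`. -/
noncomputable def torusEnd (A : Matrix (Fin 2) (Fin 2) ℤ) : C(Torus2, Torus2) where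
  toFun z := (z.1 ^ A 0 0 * z.2 ^ A 0 1, z.1 ^ A 1 0 * z.2 ^ A 1 1)

/-- The loop in the torus, parametrized by the circle, which winds `v 0` times around the first
factor and `v 1` times around the second. -/
noncomputable def windingMap (v : Fin 2 → ℤ) : C(Circle, Torus2) where
  toFun z := (z ^ v 0, z ^ v 1)

theorem torusEnd_windingMap (A : Matrix (Fin 2) (Fin 2) ℤ) (v : Fin 2 → ℤ) (z : Circle) :
    torusEnd A (windingMap v z) = windingMap (A.mulVec v) z := by
  simp [torusEnd, windingMap, Matrix.mulVec, dotProduct, Fin.sum_univ_two, ← zpow_mul, zpow_add,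
    mul_comm]

/-- Every circle-valued map on the torus is a character times the exponential of a real function.
Indeed, its argument is a real function on the plane which changes by a constant under translation
by a period; subtracting a linear function makes it periodic. -/
theorem exists_eq_exp_mul_character (f : C(Torus2, Circle)) :
    ∃ (θ : C(Torus2, ℝ)) (a b : ℤ), ∀ z, f z = Circle.exp (θ z) * (z.1 ^ a * z.2 ^ b) := by
  let E : C(ℝ × ℝ, Torus2) := ⟨fun x ↦ (Circle.exp x.1, Circle.exp x.2), by fun_prop⟩
  have hE : Topology.IsQuotientMap E := by
    have h := isLocalHomeomorph_circleExp.isOpenMap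
    exact (h.prodMap h).isQuotientMap E.continuous
      (Circle.exp_surjective.prodMap Circle.exp_surjective)
  obtain ⟨F, hF⟩ := exists_circle_lift (f.comp E)
  obtain ⟨a, ha⟩ := exists_int_of_circle_exp_eq (θ := fun x : ℝ × ℝ ↦ F (x.1 + 2 * Real.pi, x.2))
    (θ' := F) (by fun_prop) (by fun_prop) (fun x ↦ by simp [hF, E])
  obtain ⟨b, hb⟩ := exists_int_of_circle_exp_eq (θ := fun x : ℝ × ℝ ↦ F (x.1, x.2 + 2 * Real.pi))
    (θ' := F) (by fun_prop) (by fun_prop) (fun x ↦ by simp [hF, E])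
  let g : C(ℝ × ℝ, ℝ) := ⟨fun x ↦ F x - (a * x.1 + b * x.2), by fun_prop⟩
  have hg1 : ∀ y, Function.Periodic (fun x ↦ g (x, y)) (2 * Real.pi) := fun y x ↦ by
    simp only [g, ContinuousMap.coe_mk]; linarith [ha (x, y)]
  have hg2 : ∀ x, Function.Periodic (fun y ↦ g (x, y)) (2 * Real.pi) := fun x y ↦ by
    simp only [g, ContinuousMap.coe_mk]; linarith [hb (x, y)]
  have hfac : Function.FactorsThrough g E := by
    rintro ⟨x, y⟩ ⟨x', y'⟩ h
    obtain ⟨m, rfl⟩ := Circle.exp_eq_exp.mp (congrArg Prod.fst h)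
    obtain ⟨n, rfl⟩ := Circle.exp_eq_exp.mp (congrArg Prod.snd h)
    exact ((hg1 _).int_mul m x').trans ((hg2 _).int_mul n y')
  refine ⟨hE.lift g hfac, a, b, fun z ↦ ?_⟩
  obtain ⟨x, rfl⟩ := hE.surjective z
  have h1 : hE.lift g hfac (E x) = g x := congrArg (fun k ↦ k x) (hE.lift_comp g hfac)
  rw [h1, ← ContinuousMap.comp_apply, ← hF]
  change Circle.exp (F x) = Circle.exp (F x - (a * x.1 + b * x.2)) *
    (Circle.exp x.1 ^ a * Circle.exp x.2 ^ b)
  rw [← Circle.exp_intCast_mul, ← Circle.exp_intCast_mul, ← Circle.exp_add, ← Circle.exp_add,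
    sub_add_cancel]

theorem exists_homotopic_torusEnd (f : C(Torus2, Torus2)) :
    ∃ A : Matrix (Fin 2) (Fin 2) ℤ, f.Homotopic (torusEnd A) := by
  obtain ⟨θ, a, b, h⟩ := exists_eq_exp_mul_character ⟨fun z ↦ (f z).1, by fun_prop⟩
  obtain ⟨θ', a', b', h'⟩ := exists_eq_exp_mul_character ⟨fun z ↦ (f z).2, by fun_prop⟩
  -- The real functions `θ` and `θ'` are contracted linearly to zero.
  refine ⟨!![a, b; a', b'], ⟨⟨⟨fun p ↦
    (Circle.exp ((1 - p.1) * θ p.2) * (p.2.1 ^ a * p.2.2 ^ b),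
      Circle.exp ((1 - p.1) * θ' p.2) * (p.2.1 ^ a' * p.2.2 ^ b')), by fun_prop⟩, ?_, ?_⟩⟩⟩
  · intro z; ext1
    · simpa using (h z).symm
    · simpa using (h' z).symm
  · intro z; simp [torusEnd]

/-! ### Eigenvalues of an endomorphism fixing a vector after iteration -/

section Eigenvalues

open Polynomial

theorem exists_hasEigenvalue_of_aeval_prod {K V : Type*} [Field K] [AddCommGroup V] [Module K V]
    (M : Module.End K V) {y : V} (hy : y ≠ 0) (s : Multiset K)
    (h : aeval M (s.map fun μ ↦ X - C μ).prod y = 0) : ∃ μ ∈ s, M.HasEigenvalue μ := by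
  induction s using Multiset.induction with
  | empty => simp [hy] at h
  | cons μ s ih =>
    rw [Multiset.map_cons, Multiset.prod_cons, map_mul, Module.End.mul_apply] at h
    by_cases hz : aeval M (s.map fun μ ↦ X - C μ).prod y = 0
    · obtain ⟨ν, hν, hν'⟩ := ih hz
      exact ⟨ν, Multiset.mem_cons_of_mem hν, hν'⟩
    · refine ⟨μ, Multiset.mem_cons_self _ _, Module.End.hasEigenvalue_of_hasEigenvector
        (Module.End.hasEigenvector_iff.mpr ⟨Module.End.mem_eigenspace_iff.mpr ?_, hz⟩)⟩
      simpa [sub_eq_zero] using h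

/-- No finiteness of the dimension is needed: `Mᵏ - 1` is a product of factors `M - μ`. -/
theorem exists_hasEigenvalue_of_pow_apply_eq {K V : Type*} [Field K] [IsAlgClosed K]
    [AddCommGroup V] [Module K V] (M : Module.End K V) {y : V} (hy : y ≠ 0) {k : ℕ} (hk : 0 < k)
    (h : (M ^ k) y = y) : ∃ μ : K, μ ^ k = 1 ∧ M.HasEigenvalue μ := by
  have hsplit : (X ^ k - 1 : K[X]) = ((X ^ k - 1 : K[X]).roots.map fun μ ↦ X - C μ).prod := by
    have := (IsAlgClosed.splits (X ^ k - 1 : K[X])).eq_prod_roots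
    have hmonic : (X ^ k - 1 : K[X]).leadingCoeff = 1 := by
      simpa using (monic_X_pow_sub_C (1 : K) hk.ne').leadingCoeff
    rwa [hmonic, C_1, one_mul] at this
  obtain ⟨μ, hμ, hM⟩ := exists_hasEigenvalue_of_aeval_prod M hy (X ^ k - 1 : K[X]).roots (by
    rw [← hsplit]; simp [h])
  refine ⟨μ, ?_, hM⟩
  have := (mem_roots'.mp hμ).2
  simpa [sub_eq_zero] using this

end Eigenvalues

/-! ### The first homology of the circle and of the torus -/

section Homology

open CategoryTheory AlgebraicTopology Simplicial

instance contractibleSpace_stdSimplex (n : ℕ) : ContractibleSpace (stdSimplex ℝ (Fin (n + 1))) :=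
  (convex_stdSimplex ℝ (Fin (n + 1))).contractibleSpace ⟨_, single_mem_stdSimplex ℝ 0⟩

/-- The change of argument along a path `Δ¹ → S¹`: the difference between the end values of a
real lift. By `argIncrement_eq`, it does not depend on the lift. -/
noncomputable def argIncrement (σ : C(stdSimplex ℝ (Fin 2), Circle)) : ℝ :=
  (exists_circle_lift σ).choose (stdSimplex.vertex 1) -
    (exists_circle_lift σ).choose (stdSimplex.vertex 0)

theorem argIncrement_eq {σ : C(stdSimplex ℝ (Fin 2), Circle)}
    {θ : stdSimplex ℝ (Fin 2) → ℝ} (hθ : Continuous θ) (h : ∀ x, Circle.exp (θ x) = σ x) :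
    argIncrement σ = θ (stdSimplex.vertex 1) - θ (stdSimplex.vertex 0) := by
  obtain ⟨n, hn⟩ := exists_int_of_circle_exp_eq
    (exists_circle_lift σ).choose.continuous hθ
    (fun x ↦ ((exists_circle_lift σ).choose_spec x).trans (h x).symm)
  rw [argIncrement, hn, hn]; ring

/-- The singular chain complex of `X` with integral coefficients. -/
noncomputable abbrev singularChains (X : TopCat.{0}) : ChainComplex (ModuleCat.{0} ℤ) ℕ :=
  (TopCat.toSSet.obj X).chainComplex (ModuleCat.of ℤ ℤ)

/-- The real singular `1`-cochain on the circle whose value on a simplex is the change of argument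
along it. -/
noncomputable def argCochain :
    (singularChains (.of Circle)).X 1 ⟶ ModuleCat.of ℤ ℝ :=
  Limits.Sigma.desc fun σ : (TopCat.toSSet.obj (.of Circle)) _⦋1⦌ ↦
    ModuleCat.ofHom (LinearMap.toSpanSingleton ℤ ℝ (argIncrement (TopCat.toSSetObjEquiv _ _ σ)))

theorem ι_argCochain (σ : (TopCat.toSSet.obj (.of Circle)) _⦋1⦌) :
    (TopCat.toSSet.obj (.of Circle)).ιChainComplex σ ≫ argCochain =
      ModuleCat.ofHom (LinearMap.toSpanSingleton ℤ ℝ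
        (argIncrement (TopCat.toSSetObjEquiv _ _ σ))) :=
  Limits.Sigma.ι_desc _ _

/-- The change of argument is a cocycle: on the boundary of a `2`-simplex, it is computed from a
lift of the whole simplex. -/
theorem d_argCochain : (singularChains (.of Circle)).d 2 1 ≫ argCochain = 0 := by
  refine SSet.chainComplex_hom_ext fun σ ↦ ?_
  obtain ⟨θ, hθ⟩ := exists_circle_lift (TopCat.toSSetObjEquiv _ _ σ)
  have hδ : ∀ i : Fin 3, argIncrement (TopCat.toSSetObjEquiv _ _
      ((TopCat.toSSet.obj (.of Circle)).δ i σ)) =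
      θ (stdSimplex.vertex (i.succAbove 1)) - θ (stdSimplex.vertex (i.succAbove 0)) := by
    intro i
    rw [argIncrement_eq (θ := fun x ↦ θ (stdSimplex.map i.succAbove x))
      (θ.continuous.comp (stdSimplex.continuous_map _)), stdSimplex.map_vertex,
      stdSimplex.map_vertex]
    intro x
    rw [hθ]
    exact (TopCat.toSSetObjEquiv_δ_apply ..).symm
  rw [SSet.ιChainComplex_d_assoc, Preadditive.sum_comp, Fin.sum_univ_three]
  simp only [Preadditive.zsmul_comp, Limits.comp_zero, ι_argCochain, hδ]
  ext
  simp [Fin.succAbove]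

/-- The path `Δ¹ → S¹` running once around the circle. -/
noncomputable def circlePath : C(stdSimplex ℝ (Fin 2), Circle) :=
  Circle.exp.comp ⟨fun t ↦ 2 * Real.pi * t.1 1,
    continuous_const.mul ((continuous_apply 1).comp continuous_subtype_val)⟩

/-- The singular `1`-simplex of the circle given by `circlePath`. -/
noncomputable def circleSimplex : (TopCat.toSSet.obj (.of Circle)) _⦋1⦌ :=
  (TopCat.toSSetObjEquiv (.of Circle) _).symm circlePath

theorem δ_circleSimplex : (TopCat.toSSet.obj (.of Circle)).δ 0 circleSimplex =
    (TopCat.toSSet.obj (.of Circle)).δ 1 circleSimplex := by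
  refine (TopCat.toSSetObjEquiv _ _).injective ?_
  ext z
  rw [TopCat.toSSetObjEquiv_δ_apply, TopCat.toSSetObjEquiv_δ_apply, circleSimplex,
    Equiv.apply_symm_apply, Subsingleton.elim z (stdSimplex.vertex 0), stdSimplex.map_vertex,
    stdSimplex.map_vertex]
  simp [circlePath]

theorem circleSimplex_d : (TopCat.toSSet.obj (.of Circle)).ιChainComplex circleSimplex ≫
    (singularChains (.of Circle)).d 1 0 = 0 := by
  rw [SSet.ιChainComplex_d, Fin.sum_univ_two, δ_circleSimplex]
  simp

/-- The fundamental class of the circle, as the homomorphism from `ℤ` sending `1` to it. -/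
noncomputable def circleClassHom : ModuleCat.of ℤ ℤ ⟶ (singularChains (.of Circle)).homology 1 :=
  (singularChains (.of Circle)).liftCycles
      ((TopCat.toSSet.obj (.of Circle)).ιChainComplex circleSimplex) 0 (by simp) circleSimplex_d ≫
    (singularChains (.of Circle)).homologyπ 1

/-- The homomorphism `H₁(S¹; ℤ) → ℝ` induced by the cocycle `argCochain`. -/
noncomputable def argHom : (singularChains (.of Circle)).homology 1 ⟶ ModuleCat.of ℤ ℝ :=
  (singularChains (.of Circle)).homologyι 1 ≫
    (singularChains (.of Circle)).descOpcycles argCochain 2 (by simp) d_argCochain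

/-- The homomorphism `H₁(X; ℤ) → H₁(Y; ℤ)` induced by a continuous map. -/
noncomputable def singularHomologyOneMap {X Y : TopCat.{0}} (f : X ⟶ Y) :
    (singularChains X).homology 1 ⟶ (singularChains Y).homology 1 :=
  HomologicalComplex.homologyMap (SSet.chainComplexMap (TopCat.toSSet.map f) (ModuleCat.of ℤ ℤ)) 1

/-- The image of the fundamental class under `f` pairs with the cocycle to the total change of
argument of `f` along the circle. -/
theorem circleClassHom_map_argHom (f : C(Circle, Circle)) :
    circleClassHom ≫ singularHomologyOneMap (TopCat.ofHom f) ≫ argHom =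
      ModuleCat.ofHom (LinearMap.toSpanSingleton ℤ ℝ
        (argIncrement (f.comp circlePath))) := by
  simp only [circleClassHom, singularHomologyOneMap, argHom, Category.assoc,
    HomologicalComplex.homologyι_naturality_assoc, HomologicalComplex.homology_π_ι_assoc,
    HomologicalComplex.p_opcyclesMap_assoc, HomologicalComplex.p_descOpcycles,
    HomologicalComplex.liftCycles_i_assoc, SSet.ι_chainComplexMap_f_assoc]
  rw [ι_argCochain]
  rfl

theorem argIncrement_zpow (n : ℤ) :
    argIncrement (ContinuousMap.comp ⟨fun z ↦ z ^ n, by fun_prop⟩ circlePath) =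
      2 * Real.pi * n := by
  rw [argIncrement_eq (θ := fun t ↦ n * (2 * Real.pi * t.1 1)) (continuous_const.mul
    (continuous_const.mul ((continuous_apply 1).comp continuous_subtype_val)))]
  · simp; ring
  · intro t
    rw [Circle.exp_intCast_mul]
    rfl

open TensorProduct

/-- The homology class of the loop `windingMap v` in the torus. -/
noncomputable def windingClass (v : Fin 2 → ℤ) : singularH1 Torus2 :=
  (circleClassHom ≫ singularHomologyOneMap (TopCat.ofHom (windingMap v))).hom (1 : ℤ)

theorem singularHomologyOneMap_comp {X Y Z : TopCat.{0}} (f : X ⟶ Y) (g : Y ⟶ Z) :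
    singularHomologyOneMap (f ≫ g) = singularHomologyOneMap f ≫ singularHomologyOneMap g := by
  simp only [singularHomologyOneMap, SSet.chainComplexMap, Functor.map_comp,
    HomologicalComplex.homologyMap_comp]

theorem singularH1Map_windingClass {f : C(Torus2, Torus2)} {A : Matrix (Fin 2) (Fin 2) ℤ}
    (hf : f.Homotopic (torusEnd A)) (v : Fin 2 → ℤ) :
    singularH1Map f (windingClass v) = windingClass (A.mulVec v) := by
  obtain ⟨F⟩ := hf
  have h1 : singularH1Map f = (singularHomologyOneMap (TopCat.ofHom (torusEnd A))).hom :=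
    congrArg ModuleCat.Hom.hom
      (TopCat.Homotopy.congr_homologyMap_singularChainComplexFunctor
        (f := TopCat.ofHom f) (g := TopCat.ofHom (torusEnd A)) F (ModuleCat.of ℤ ℤ) 1)
  have h2 : TopCat.ofHom (windingMap (A.mulVec v)) =
      TopCat.ofHom (windingMap v) ≫ TopCat.ofHom (torusEnd A) := by
    exact congrArg TopCat.ofHom (ContinuousMap.ext fun z ↦ (torusEnd_windingMap A v z).symm)
  rw [h1, windingClass, windingClass, h2, singularHomologyOneMap_comp]
  rfl

/-- A coordinate in which `v` does not vanish maps the torus to the circle, where the change of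
argument detects the image of the class. -/
theorem exists_linearMap_windingClass_ne_zero {v : Fin 2 → ℤ} (hv : v ≠ 0) :
    ∃ D : singularH1 Torus2 →ₗ[ℤ] ℝ, D (windingClass v) ≠ 0 := by
  have key : ∀ (i : Fin 2) (f : C(Torus2, Circle)), (∀ z, f (windingMap v z) = z ^ v i) →
      v i ≠ 0 →
      ∃ D : singularH1 Torus2 →ₗ[ℤ] ℝ, D (windingClass v) ≠ 0 := by
    intro i f hf hi
    refine ⟨(singularHomologyOneMap (TopCat.ofHom f) ≫ argHom).hom, ?_⟩
    have h1 : TopCat.ofHom (windingMap v) ≫ TopCat.ofHom f =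
        TopCat.ofHom ⟨fun z : Circle ↦ z ^ v i, by fun_prop⟩ :=
      congrArg TopCat.ofHom (ContinuousMap.ext hf)
    have h2 := circleClassHom_map_argHom ⟨fun z : Circle ↦ z ^ v i, by fun_prop⟩
    rw [← h1, singularHomologyOneMap_comp, argIncrement_zpow] at h2
    have h3 := congrArg (fun g ↦ ModuleCat.Hom.hom g (1 : ℤ)) h2
    have h4 : (singularHomologyOneMap (TopCat.ofHom f) ≫ argHom).hom (windingClass v) =
        2 * Real.pi * v i := by
      simpa [windingClass] using h3
    have h5 : (v i : ℝ) ≠ 0 := by exact_mod_cast hi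
    exact h4.trans_ne (by positivity)
  obtain ⟨i, hi⟩ := Function.ne_iff.mp hv
  fin_cases i
  · exact key 0 ⟨Prod.fst, continuous_fst⟩ (fun z ↦ rfl) hi
  · exact key 1 ⟨Prod.snd, continuous_snd⟩ (fun z ↦ rfl) hi

theorem one_tmul_windingClass_ne_zero {v : Fin 2 → ℤ} (hv : v ≠ 0) :
    (1 : ℂ) ⊗ₜ[ℤ] windingClass v ≠ 0 := by
  obtain ⟨D, hD⟩ := exists_linearMap_windingClass_ne_zero hv
  intro h
  have h1 := congrArg (TensorProduct.lift
    ((LinearMap.mul ℤ ℂ).compl₂ ((Complex.ofRealAm.toLinearMap.restrictScalars ℤ).comp D))) h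
  simp [hD] at h1

/-- If the eigenvalues of `f` on `H₁(T; ℤ)` are `e⁻ᵗ` and `eᵗ` with `t > 0`, then no positive power
of the matrix of `f` has eigenvalue `1`. -/
theorem det_pow_sub_one_ne_zero {f : C(Torus2, Torus2)} {A : Matrix (Fin 2) (Fin 2) ℤ}
    (hf : f.Homotopic (torusEnd A)) {t : ℝ} (ht : 0 < t)
    (hev : complexEigenvalues (singularH1Map f) =
      {((Real.exp (-t) : ℝ) : ℂ), ((Real.exp t : ℝ) : ℂ)}) {k : ℕ} (hk : 0 < k) :
    (A ^ k - 1).det ≠ 0 := by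
  intro hdet
  obtain ⟨v, hv, hAv⟩ := Matrix.exists_mulVec_eq_zero_iff.mpr hdet
  rw [Matrix.sub_mulVec, Matrix.one_mulVec, sub_eq_zero] at hAv
  have hpow : ∀ m : ℕ, (((singularH1Map f).baseChange ℂ) ^ m) ((1 : ℂ) ⊗ₜ[ℤ] windingClass v) =
      (1 : ℂ) ⊗ₜ[ℤ] windingClass ((A ^ m).mulVec v) := by
    intro m
    induction m with
    | zero => simp
    | succ m ih =>
      rw [pow_succ', Module.End.mul_apply, ih, LinearMap.baseChange_tmul,
        singularH1Map_windingClass hf, Matrix.mulVec_mulVec, pow_succ']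
  obtain ⟨μ, hμ, hM⟩ := exists_hasEigenvalue_of_pow_apply_eq ((singularH1Map f).baseChange ℂ)
    (one_tmul_windingClass_ne_zero hv) hk (by rw [hpow, hAv])
  have hmem : μ ∈ complexEigenvalues (singularH1Map f) := hM
  have hnorm : ‖μ‖ = 1 := Complex.norm_eq_one_of_pow_eq_one hμ hk.ne'
  rw [hev] at hmem
  rcases hmem with rfl | rfl
  · rw [Complex.norm_real, Real.norm_of_nonneg (Real.exp_pos _).le, Real.exp_eq_one_iff] at hnorm
    linarith
  · rw [Complex.norm_real, Real.norm_of_nonneg (Real.exp_pos _).le, Real.exp_eq_one_iff] at hnorm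
    linarith

end Homology

/-! ### Loops in the torus -/

section Loops

open unitInterval

theorem circleLoop_zero : circleLoop 0 = 1 := by simp [circleLoop]

theorem circleLoop_one : circleLoop 1 = 1 := by simp [circleLoop]

theorem continuous_circleLoop : Continuous circleLoop := by unfold circleLoop; fun_prop

theorem circleLoop_surjective : Function.Surjective circleLoop := by
  intro z
  obtain ⟨x, rfl⟩ := Circle.exp_surjective z
  have hpi : (2 * Real.pi) ≠ 0 := by positivity
  refine ⟨⟨Int.fract (x / (2 * Real.pi)), Int.fract_nonneg _, (Int.fract_lt_one _).le⟩, ?_⟩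
  refine Circle.exp_eq_exp.mpr ⟨-⌊x / (2 * Real.pi)⌋, ?_⟩
  simp only [Int.fract]
  field_simp
  push_cast; ring

/-- The loop `windingMap v`, as a path based at `1`. -/
noncomputable def windingPath (v : Fin 2 → ℤ) : Path (1 : Torus2) 1 where
  toFun s := windingMap v (circleLoop s)
  continuous_toFun := (windingMap v).continuous.comp continuous_circleLoop
  source' := by simp [windingMap, circleLoop_zero]
  target' := by simp [windingMap, circleLoop_one]

/-- In a topological monoid, the pointwise product of two loops based at `1` is homotopic to their
concatenation: pad one with a constant path at the end, the other at the start. -/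
theorem Path.Homotopic.trans_of_eq_mul {G : Type*} [TopologicalSpace G] [Monoid G] [ContinuousMul G]
    {p q r : Path (1 : G) 1} (h : ∀ s, r s = p s * q s) : (p.trans q).Homotopic r := by
  let F := Path.Homotopy.transRefl p
  let F' := Path.Homotopy.reflTrans q
  refine ⟨⟨⟨⟨fun x ↦ F x * F' x, by fun_prop⟩, fun s ↦ ?_, fun s ↦ ?_⟩, fun t s hs ↦ ?_⟩⟩
  · simp [Path.trans_apply]
    split_ifs <;> simp
  · simp [h]
  · rcases hs with rfl | rfl <;> simp

/-- The homomorphism `ℤ² → π₁(T, 1)` sending `v` to the class of the loop of winding vector `v`. -/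
noncomputable def windingHom : Multiplicative (Fin 2 → ℤ) →* FundamentalGroup Torus2 1 :=
  MonoidHom.mk' (fun v ↦ Path.Homotopic.Quotient.mk (windingPath v.toAdd)) fun v w ↦ by
    rw [FundamentalGroup.mul_def]
    refine ((Path.Homotopic.Quotient.eq).mpr (Path.Homotopic.trans_of_eq_mul fun s ↦ ?_)).symm
    simp [windingPath, windingMap, zpow_add, mul_comm]

instance contractibleSpace_unitInterval : ContractibleSpace I :=
  (convex_Icc (0 : ℝ) 1).contractibleSpace ⟨0, by simp⟩

/-- A null-homotopy of the `n`-th power of the standard loop forces `n = 0`: the argument of the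
homotopy is constant along three sides of the square and increases by `2πn` along the fourth. -/
theorem eq_zero_of_nullhomotopic_circleLoop_zpow {n : ℤ} (K : C(I × I, Circle))
    (h0 : ∀ s, K (0, s) = circleLoop s ^ n) (h1 : ∀ s, K (1, s) = 1)
    (hl : ∀ t, K (t, 0) = 1) (hr : ∀ t, K (t, 1) = 1) : n = 0 := by
  obtain ⟨θ, hθ⟩ := exists_circle_lift K
  have const : ∀ γ : C(I, I × I), (∀ t, K (γ t) = 1) → θ (γ 0) = θ (γ 1) := fun γ hγ ↦
    eq_of_circle_exp_eq_one (θ := θ ∘ γ) (by fun_prop) (fun t ↦ by simp [hθ, hγ]) 0 1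
  have e1 := const ⟨fun t ↦ (t, 0), by fun_prop⟩ hl
  have e2 := const ⟨fun t ↦ (t, 1), by fun_prop⟩ hr
  have e3 := const ⟨fun t ↦ (1, t), by fun_prop⟩ h1
  obtain ⟨m, hm⟩ := exists_int_of_circle_exp_eq (θ := fun s : I ↦ θ (0, s))
    (θ' := fun s : I ↦ n * (2 * Real.pi * s)) (by fun_prop) (by fun_prop) (fun s ↦ by
      rw [hθ, h0, Circle.exp_intCast_mul]; rfl)
  have e4 := hm 0
  have e5 := hm 1
  simp only [ContinuousMap.coe_mk, Set.Icc.coe_zero, Set.Icc.coe_one] at e1 e2 e3 e4 e5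
  have : (n : ℝ) * (2 * Real.pi) = 0 := by linarith
  have := (mul_eq_zero.mp this).resolve_right (by positivity)
  exact_mod_cast this

/-! ### Bundles over the circle -/

section Bundle

variable {F : Type v} [TopologicalSpace F] {E : Type u} [TopologicalSpace E] {q : E → Circle}
  (Φ : F × I ≃ₜ LoopPullback q)

/-- The point of the pull-back along the loop given by `s` and `n`. -/
def LoopPullback.mk (s : I) (n : E) (h : circleLoop s = q n) : LoopPullback q := ⟨(s, n), h⟩

theorem loopTrivialization_symm_snd (hΦ : ∀ x s, (Φ (x, s)).1.1 = s) (z : LoopPullback q) :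
    (Φ.symm z).2 = z.1.1 := by
  conv_rhs => rw [← Φ.apply_symm_apply z]
  exact (hΦ _ _).symm

/-- The fibre coordinates of a point over `1 ∈ S¹` at the two ends of the loop differ by `h`. -/
theorem loopTrivialization_symm_zero_eq {h : F ≃ₜ F} (hΦ : ∀ x s, (Φ (x, s)).1.1 = s)
    (hh : ∀ x, (Φ (x, 1)).1.2 = (Φ (h x, 0)).1.2) {n : E} (h1 : circleLoop 1 = q n)
    (h0 : circleLoop 0 = q n) :
    (Φ.symm (.mk 0 n h0)).1 = h (Φ.symm (.mk 1 n h1)).1 := by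
  set y := (Φ.symm (.mk 1 n h1)).1 with hy
  have e1 : Φ.symm (.mk 1 n h1) = (y, 1) := Prod.ext rfl (loopTrivialization_symm_snd Φ hΦ _)
  have e2 : Φ (y, 1) = (.mk 1 n h1) := by rw [← e1]; exact Φ.apply_symm_apply _
  have e3 : Φ (h y, 0) = (.mk 0 n h0) :=
    Subtype.ext (Prod.ext (hΦ _ _) ((hh y).symm.trans (by rw [e2]; rfl)))
  rw [← e3, Φ.symm_apply_apply]

/-- The total space of the pull-back of `q : E → S¹` along the universal covering
`x ↦ exp (2πix)` of the circle. -/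
abbrev RealPullback (q : E → Circle) := {z : ℝ × E // Circle.exp (2 * Real.pi * z.1) = q z.2}

/-- The pull-back of the bundle to `ℝ` maps to the fibre, compatibly with the given identification
of the fibre over `0`: over `[k, k + 1]` the map is the fibre coordinate followed by `h⁻ᵏ`. -/
theorem exists_retraction_realPullback {h : F ≃ₜ F} (hΦ : ∀ x s, (Φ (x, s)).1.1 = s)
    (hh : ∀ x, (Φ (x, 1)).1.2 = (Φ (h x, 0)).1.2) :
    ∃ R : RealPullback q → F, Continuous R ∧
      ∀ (y : F) (hy : Circle.exp (2 * Real.pi * 0) = q (Φ (y, 0)).1.2),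
        R ⟨(0, (Φ (y, 0)).1.2), hy⟩ = y := by
  have hmem : ∀ (z : RealPullback q) (k : ℤ), Circle.exp (2 * Real.pi * (z.1.1 - k)) = q z.1.2 := by
    intro z k
    rw [← z.2, Circle.exp_eq_exp]
    exact ⟨-k, by push_cast; ring⟩
  let c : ∀ (k : ℤ) (z : RealPullback q), z.1.1 - k ∈ Set.Icc (0 : ℝ) 1 → F := fun k z hz ↦
    (Φ.symm (.mk ⟨z.1.1 - k, hz⟩ z.1.2 (hmem z k))).1
  let R : RealPullback q → F := fun z ↦ (h ^ (-⌊z.1.1⌋)) (c ⌊z.1.1⌋ z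
    ⟨sub_nonneg.mpr (Int.floor_le _), by linarith [Int.lt_floor_add_one z.1.1]⟩)
  -- The formula remains valid at the right end point of each interval, where the floor jumps.
  have hR : ∀ (k : ℤ) (z : RealPullback q) (hz : z.1.1 - k ∈ Set.Icc (0 : ℝ) 1),
      R z = (h ^ (-k)) (c k z hz) := by
    intro k z hz
    have h0 : (k : ℝ) ≤ z.1.1 := sub_nonneg.mp hz.1
    rcases hz.2.lt_or_eq with hlt | heq
    · have hf : ⌊z.1.1⌋ = k := Int.floor_eq_iff.mpr ⟨h0, by linarith⟩
      simp only [R, hf]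
    · have hf : ⌊z.1.1⌋ = k + 1 :=
        Int.floor_eq_iff.mpr ⟨by push_cast; linarith, by push_cast; linarith⟩
      have hz' : z.1.1 - (k + 1 : ℤ) ∈ Set.Icc (0 : ℝ) 1 := by
        push_cast; constructor <;> linarith
      have h1 : R z = (h ^ (-(k + 1))) (c (k + 1) z hz') := by simp only [R, hf]
      have h2 : c (k + 1) z hz' = h (c k z hz) := by
        have e0 : (⟨z.1.1 - (k + 1 : ℤ), hz'⟩ : I) = 0 := Subtype.ext (by push_cast; linarith)
        have e1 : (⟨z.1.1 - k, hz⟩ : I) = 1 := Subtype.ext heq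
        simp only [c, e0, e1]
        exact loopTrivialization_symm_zero_eq Φ hΦ hh _ _
      rw [h1, h2, neg_add, zpow_add, zpow_neg_one]
      change (h ^ (-k)) (h⁻¹ (h (c k z hz))) = _
      congr 1
      exact h.symm_apply_apply _
  refine ⟨R, ?_, fun y hy ↦ ?_⟩
  · have hlf : LocallyFinite fun k : ℤ ↦ {z : RealPullback q | z.1.1 - k ∈ Set.Icc (0 : ℝ) 1} := by
      refine LocallyFinite.preimage_continuous (g := fun z : RealPullback q ↦ z.1.1)
        (f := fun k : ℤ ↦ {x : ℝ | x - k ∈ Set.Icc (0 : ℝ) 1}) ?_ (by fun_prop)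
      intro x
      refine ⟨Set.Ioo (x - 1) (x + 1), Ioo_mem_nhds (by linarith) (by linarith),
        (Set.finite_Icc ⌊x - 2⌋ ⌈x + 1⌉).subset ?_⟩
      rintro k ⟨y, ⟨hy1, hy2⟩, hy3, hy4⟩
      exact ⟨Int.floor_le_iff.mpr (by linarith), Int.le_ceil_iff.mpr (by linarith)⟩
    refine hlf.continuous ?_ ?_ ?_
    · refine Set.eq_univ_of_forall fun z ↦ Set.mem_iUnion.mpr ⟨⌊z.1.1⌋, ?_⟩
      exact ⟨sub_nonneg.mpr (Int.floor_le _), by linarith [Int.lt_floor_add_one z.1.1]⟩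
    · exact fun k ↦ isClosed_Icc.preimage (f := fun z : RealPullback q ↦ z.1.1 - k) (by fun_prop)
    · intro k
      rw [continuousOn_iff_continuous_domRestrict]
      have : Set.domRestrict {z : RealPullback q | z.1.1 - k ∈ Set.Icc (0 : ℝ) 1} R =
          fun z ↦ (h ^ (-k)) (c k z.1 z.2) := funext fun z ↦ hR k z.1 z.2
      rw [this]
      refine (h ^ (-k)).continuous.comp (continuous_fst.comp (Φ.symm.continuous.comp ?_))
      exact Continuous.subtype_mk
        (f := fun z : {z : RealPullback q | z.1.1 - k ∈ Set.Icc (0 : ℝ) 1} ↦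
          ((⟨z.1.1.1 - k, z.2⟩ : I), z.1.1.2)) (by fun_prop) _
  · have hz : ((0 : ℝ) - (0 : ℤ)) ∈ Set.Icc (0 : ℝ) 1 := by simp
    rw [hR 0 _ hz]
    have e1 : (⟨(0 : ℝ) - (0 : ℤ), hz⟩ : I) = 0 := Subtype.ext (by simp)
    have e2 : Φ (y, 0) = .mk ⟨(0 : ℝ) - (0 : ℤ), hz⟩ (Φ (y, 0)).1.2
        (by rw [e1]; exact (congrArg circleLoop (hΦ y 0)).symm.trans (Φ (y, 0)).2) :=
      Subtype.ext (Prod.ext ((hΦ y 0).trans e1.symm) rfl)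
    simp only [c, ← e2, Φ.symm_apply_apply]
    simp

/-- The map from the product of the fibre with `[0, 1]` to the total space given by a
trivialization over the loop. -/
def loopMap : C(F × I, E) := ⟨fun x ↦ (Φ x).1.2,
  continuous_snd.comp (continuous_subtype_val.comp Φ.continuous)⟩

theorem apply_loopMap (hΦ : ∀ x s, (Φ (x, s)).1.1 = s) (x : F) (s : I) :
    q (loopMap Φ (x, s)) = circleLoop s := by
  exact (Φ (x, s)).2.symm.trans (congrArg circleLoop (hΦ x s))

theorem loopMap_surjective : Function.Surjective (loopMap Φ) := by
  intro n
  obtain ⟨s, hs⟩ := circleLoop_surjective (q n)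
  exact ⟨Φ.symm (.mk s n hs),
    congrArg (fun z : LoopPullback q ↦ z.1.2) (Φ.apply_symm_apply (.mk s n hs))⟩

/-- The inclusion of the fibre over `1`, identified with `F` at the start of the loop. -/
def fibreInclusion : C(F, E) := (loopMap Φ).comp ⟨fun x ↦ (x, 0), by fun_prop⟩

/-- Moving the fibre once around the loop is a homotopy from its inclusion to the inclusion
precomposed with the monodromy. -/
def fibreHomotopy {h : F ≃ₜ F} (hh : ∀ x, (Φ (x, 1)).1.2 = (Φ (h x, 0)).1.2) :
    (fibreInclusion Φ).Homotopy ((fibreInclusion Φ).comp (h : C(F, F))) where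
  toContinuousMap := (loopMap Φ).comp ⟨Prod.swap, continuous_swap⟩
  map_zero_left _ := rfl
  map_one_left x := hh x

end Bundle

/-- The inclusion of the fibre is injective on the classes of the loops of winding vectors `v`. -/
theorem fibre_winding_injective {E : Type u} [TopologicalSpace E] {q : E → Circle}
    (hq : Continuous q)
    (Φ : Torus2 × I ≃ₜ LoopPullback q) {h : Torus2 ≃ₜ Torus2} (hΦ : ∀ x s, (Φ (x, s)).1.1 = s)
    (hh : ∀ x, (Φ (x, 1)).1.2 = (Φ (h x, 0)).1.2) :
    Function.Injective ((FundamentalGroup.map (fibreInclusion Φ) 1).comp windingHom) := by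
  rw [injective_iff_map_eq_one]
  intro v hv
  obtain ⟨H⟩ : ((windingPath v.toAdd).map (fibreInclusion Φ).continuous).Homotopic
      (Path.refl (fibreInclusion Φ 1)) :=
    Path.Homotopic.Quotient.eq.mp hv
  have hq0 : ∀ y, q (fibreInclusion Φ y) = 1 := fun y ↦
    (apply_loopMap Φ hΦ y 0).trans circleLoop_zero
  -- The argument `θ` of the projected homotopy is constant on the boundary of the square, so that
  -- `θ - θ (0, 0)` together with `H` is a homotopy in the pull-back whose boundary lies over `0`.
  obtain ⟨θ, hθ⟩ := exists_circle_lift (⟨q ∘ H, by fun_prop⟩ : C(I × I, Circle))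
  have const : ∀ γ : C(I, I × I), (∀ t, q (H (γ t)) = 1) → ∀ s t, θ (γ s) = θ (γ t) := fun γ hγ ↦
    eq_of_circle_exp_eq_one (θ := θ ∘ γ) (by fun_prop) (fun t ↦ by simpa [hθ] using hγ t)
  obtain ⟨m, hm⟩ := Circle.exp_eq_one.mp
    ((hθ (0, 0)).trans (by simp [hq0]) : Circle.exp (θ (0, 0)) = 1)
  have s0 : ∀ s, θ (0, s) = θ (0, 0) := fun s ↦
    const ⟨fun t ↦ (0, t), by fun_prop⟩ (fun t ↦ by simp [hq0]) s 0
  have sl : ∀ t, θ (t, 0) = θ (0, 0) := fun s ↦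
    const ⟨fun t ↦ (t, 0), by fun_prop⟩ (fun t ↦ by simp [hq0]) s 0
  have sr : ∀ t, θ (t, 1) = θ (0, 0) := fun s ↦
    (const ⟨fun t ↦ (t, 1), by fun_prop⟩ (fun t ↦ by simp [hq0]) s 0).trans (s0 1)
  have s1 : ∀ s, θ (1, s) = θ (0, 0) := fun s ↦
    (const ⟨fun t ↦ (1, t), by fun_prop⟩ (fun t ↦ by simp [hq0]) s 0).trans (sl 1)
  obtain ⟨R, hRc, hR⟩ := exists_retraction_realPullback Φ hΦ hh
  have hmem : ∀ x, Circle.exp (2 * Real.pi * ((θ x - θ (0, 0)) / (2 * Real.pi))) = q (H x) := by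
    intro x
    rw [mul_div_cancel₀ _ (by positivity), hm, Circle.exp_eq_exp.mpr ⟨-m, by push_cast; ring⟩]
    exact hθ x
  let K : C(I × I, Torus2) := ⟨fun x ↦ R ⟨((θ x - θ (0, 0)) / (2 * Real.pi), H x), hmem x⟩,
    hRc.comp (Continuous.subtype_mk (by fun_prop) _)⟩
  have hK : ∀ x y, θ x = θ (0, 0) → H x = fibreInclusion Φ y → K x = y := by
    intro x y hx hy
    have e : (⟨((θ x - θ (0, 0)) / (2 * Real.pi), H x), hmem x⟩ :
        RealPullback q) =
        ⟨(0, fibreInclusion Φ y), by simp [hq0]⟩ := Subtype.ext (Prod.ext (by simp [hx]) hy)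
    exact (congrArg R e).trans (hR y _)
  have K0 : ∀ s, K (0, s) = windingMap v.toAdd (circleLoop s) := fun s ↦
    hK _ _ (s0 s) (by simp; rfl)
  have K1 : ∀ s, K (1, s) = 1 := fun s ↦ hK _ _ (s1 s) (by simp)
  have Kl : ∀ s, K (s, 0) = 1 := fun s ↦ hK _ _ (sl s) (by simp)
  have Kr : ∀ s, K (s, 1) = 1 := fun s ↦ hK _ _ (sr s) (by simp)
  refine Multiplicative.toAdd.injective (funext fun i ↦ ?_)
  fin_cases i
  · exact eq_zero_of_nullhomotopic_circleLoop_zpow ⟨fun x ↦ (K x).1, by fun_prop⟩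
      (fun s ↦ congrArg Prod.fst (K0 s)) (fun s ↦ congrArg Prod.fst (K1 s))
      (fun s ↦ congrArg Prod.fst (Kl s)) (fun s ↦ congrArg Prod.fst (Kr s))
  · exact eq_zero_of_nullhomotopic_circleLoop_zpow ⟨fun x ↦ (K x).2, by fun_prop⟩
      (fun s ↦ congrArg Prod.snd (K0 s)) (fun s ↦ congrArg Prod.snd (K1 s))
      (fun s ↦ congrArg Prod.snd (Kl s)) (fun s ↦ congrArg Prod.snd (Kr s))

/-- If `f` is homotopic to `f ∘ A`, then the track of the base point under the homotopy conjugates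
the class of `f` applied to the loop `v` into that of `f` applied to the loop `A v`. -/
theorem exists_conj_eq {E : Type u} [TopologicalSpace E] {f : C(Torus2, E)}
    {A : Matrix (Fin 2) (Fin 2) ℤ} (M : f.Homotopy (f.comp (torusEnd A))) :
    ∃ t : FundamentalGroup E (f 1), ∀ v,
      t * (FundamentalGroup.map f 1).comp windingHom (.ofAdd v) =
        (FundamentalGroup.map f 1).comp windingHom (.ofAdd (A.mulVec v)) * t := by
  have h1 : torusEnd A 1 = 1 := by simp [torusEnd]
  have h2 : f 1 = f (torusEnd A 1) := by rw [h1]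
  refine ⟨Path.Homotopic.Quotient.mk ((M.evalAt 1).cast rfl h2), fun v ↦ ?_⟩
  rw [FundamentalGroup.mul_def, FundamentalGroup.mul_def]
  refine Path.Homotopic.Quotient.eq.mpr (?_ : Path.Homotopic
    (((windingPath v).map f.continuous).trans ((M.evalAt 1).cast rfl h2))
    (((M.evalAt 1).cast rfl h2).trans ((windingPath (A.mulVec v)).map f.continuous)))
  obtain ⟨K⟩ := Path.Homotopic.map_trans_evalAt M (windingPath v)
  refine ⟨(K.pathCast rfl h2).cast ?_ ?_⟩
  · ext s; simp [Path.trans_apply]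
  · ext s
    simp [Path.trans_apply, windingPath, torusEnd_windingMap]

end Loops

theorem mainTheorem3 {N : Type u} [TopologicalSpace N] (hN : IsSolTorusBundle N) (x : N) :
    ¬ ∃ H : Subgroup (FundamentalGroup N x), H.FiniteIndex ∧
        ∀ p : ℕ, p.Prime → IsResiduallyP p H := by
  obtain ⟨q, hq, h, ⟨Φ, hΦ, hh⟩, t, ht, hev⟩ := hN
  have hqc : Continuous q := continuous_iff_continuousAt.mpr fun n ↦ by
    obtain ⟨e, he⟩ := hq (q n)
    exact e.continuousAt_proj (e.mem_source.mpr he)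
  have : PathConnectedSpace N := (loopMap_surjective Φ).pathConnectedSpace (loopMap Φ).continuous
  obtain ⟨A, hA⟩ := exists_homotopic_torusEnd (h : C(Torus2, Torus2))
  obtain ⟨J⟩ := hA
  obtain ⟨s, hs⟩ := exists_conj_eq ((fibreHomotopy Φ hh).trans (.comp (.refl (fibreInclusion Φ)) J))
  let b : FundamentalGroup N (fibreInclusion Φ 1) ≃* FundamentalGroup N x :=
    FundamentalGroup.fundamentalGroupMulEquivOfPathConnected _ _
  refine not_residuallyP_of_hyperbolic_conj (A := A)
    (i := b.toMonoidHom.comp ((FundamentalGroup.map (fibreInclusion Φ) 1).comp windingHom))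
    (t := b s)
    (fun k hk ↦ det_pow_sub_one_ne_zero ⟨J⟩ ht hev hk)
    (b.injective.comp (fibre_winding_injective hqc Φ hΦ hh)) fun v ↦ ?_
  have := congrArg b (hs v)
  rwa [map_mul, map_mul] at this
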